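/- Let $\mathbb{N}^{\infty}$ be the poset of sequences $\mathbf{x}=(x_1,x_2,\ldots)$ of natural numbers with all but finitely many entries $0$, ordered componentwise. Let $\mathcal{C}$ be a combinatorial category of type $\mathbb{N}^{\infty}$: a small skeletal category in which every endomorphism is an isomorphism, such that 1. there is a functor $\iota:\mathbb{N}^{\infty}\to\mathcal{C}$ which is a bijection on objects and identifies the order of $\mathbb{N}^{\infty}$ with the partial order on $\mathrm{Ob}(\mathcal{C})$ given by $x\preccurlyeq y \Leftrightarrow \mathcal{C}(x,y)\neq\emptyset$; 2. for all objects $x,y$, the group $G_x=\mathcal{C}(x,x)$ acts freely and transitively on $\mathcal{C}(x,y)$ from the right; 3. for all objects $x,y$, the group $G_y$ acts transitively on $\mathcal{C}(x,y)$ from the left (conditions 2 and 3 being vacuous when $\mathcal{C}(x,y)=\emptyset$). Let $k$ be a commutative ring. A $\mathcal{C}$-module is a functor $V:\mathcal{C}\to k\text{-}\mathrm{Mod}$. Let $\mathfrak{I}$ be the ideal of the category algebra $k\mathcal{C}$ spanned by the morphisms between distinct objects, let $H_0(V)=k\mathcal{C}/\mathfrak{I}\otimes_{k\mathcal{C}}V$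 be the $\mathcal{C}$-module with value $$H_0(V)_x = V_x\Big/\sum_{y\neq x,\ f\in\mathcal{C}(y,x)}V_f(V_y)$$ at $x$, and let $H_s(V)=\mathrm{Tor}_s^{k\mathcal{C}}(k\mathcal{C}/\mathfrak{I},V)$ be the $s$-th left derived functor of $H_0$. Identify objects of $\mathcal{C}$ with elements of $\mathbb{N}^{\infty}$ through $\iota$, let $\|\mathbf{x}\|=\sup_i x_i$, and put $$\mathrm{hd}_s(V)=\sup\{\|\mathbf{x}\| : H_s(V)_{\mathbf{x}}\neq 0\}\in\{-1\}\cup\mathbb{N}\cup\{\infty\},$$ with value $-1$ if the set is empty. Then for every $\mathcal{C}$-module $V$ and every $s\geq 0$, $$\mathrm{hd}_s(V)\leq\max\{\mathrm{hd}_0(V),\mathrm{hd}_1(V)\}.$$ Moreover, the full subcategory of $\mathcal{C}\text{-}\mathrm{Mod}$ on the modules presented in finite degrees, that is, those $V$ with $\mathrm{hd}_0(V)<\infty$ and $\mathrm{hd}_1(V)<\infty$, is an abelian subcategory: it is abelian, and its inclusion into $\mathcal{C}\text{-}\mathrm{Mod}$ is exact. -/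

import Mathlib

open CategoryTheory CategoryTheory.Limits

universe t u v w

namespace NInftyRep

/-! ### Combinatorial categories of type `ℕ^∞` -/

/-- A skeletal EI category: isomorphic objects are equal and every endomorphism is an
isomorphism (so that the monoid `x ⟶ x` is the group `G_x`). -/
class SkeletalEI (C : Type u) [Category.{v} C] : Prop where
  skeletal : Skeletal C
  isIso_of_endo : ∀ {x : C} (f : x ⟶ x), IsIso f

/-- A skeletal EI category `C` together with a functor `ι` from the poset `ℕ^∞` (finitely
supported sequences of natural numbers with the componentwise order, i.e. `ℕ →₀ ℕ`) is a
combinatorial category of type `ℕ^∞`. Note that `g ≫ f` is the composite `f ∘ g`. -/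
structure IsCombinatorial {C : Type u} [Category.{v} C] [SkeletalEI C]
    (ι : (ℕ →₀ ℕ) ⥤ C) : Prop where
  /-- `ι` is a bijection between the sets of objects. -/
  bijective_obj : Function.Bijective ι.obj
  /-- Under this bijection the partial order "there is a morphism `x ⟶ y`" on the objects of `C`
  is the order of `ℕ^∞` (the other implication holds because `ι` is a functor). -/
  le_of_hom : ∀ {a b : ℕ →₀ ℕ}, (ι.obj a ⟶ ι.obj b) → a ≤ b
  /-- `G_x` acts freely on `C(x, y)` from the right. -/
  right_free : ∀ {x y : C} (g : x ⟶ x) (f : x ⟶ y), g ≫ f = f → g = 𝟙 x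
  /-- `G_x` acts transitively on `C(x, y)` from the right. -/
  right_transitive : ∀ {x y : C} (f f' : x ⟶ y), ∃ g : x ⟶ x, g ≫ f = f'
  /-- `G_y` acts transitively on `C(x, y)` from the left. -/
  left_transitive : ∀ {x y : C} (f f' : x ⟶ y), ∃ g : y ⟶ y, f ≫ g = f'

/-- The sup norm of a finitely supported sequence: its largest entry. -/
def supNorm (a : ℕ →₀ ℕ) : ℕ := a.support.sup a

/-! ### The zeroth homology functor -/

section Homology

variable {C : Type u} [Category.{v} C] {k : Type w} [CommRing k]

/-- The submodule `∑_{y ≠ x, f : y ⟶ x} V_f (V_y)` of `V_x`, that is `(𝔍 V)_x`, where `𝔍` is the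
ideal of the category algebra spanned by the morphisms between distinct objects. -/
def idealImage (V : C ⥤ ModuleCat.{t} k) (x : C) : Submodule k (V.obj x) :=
  ⨆ (y : C) (_ : y ≠ x) (f : y ⟶ x), LinearMap.range (V.map f).hom

theorem idealImage_le_comap [SkeletalEI C] (V : C ⥤ ModuleCat.{t} k) {x z : C} (g : x ⟶ z) :
    idealImage V x ≤ (idealImage V z).comap (V.map g).hom := by
  refine iSup_le fun y => iSup_le fun hy => iSup_le fun f => ?_
  have hyz : y ≠ z := by
    rintro rfl
    refine hy (SkeletalEI.skeletal ⟨?_⟩)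
    have h1 := SkeletalEI.isIso_of_endo (f ≫ g)
    have h2 := SkeletalEI.isIso_of_endo (g ≫ f)
    have : IsSplitMono f := ⟨⟨g ≫ inv (f ≫ g), by rw [← Category.assoc]; simp⟩⟩
    have : IsSplitEpi f := ⟨⟨inv (g ≫ f) ≫ g, by simp⟩⟩
    have : IsIso f := isIso_of_mono_of_isSplitEpi f
    exact asIso f
  rintro _ ⟨a, rfl⟩
  refine Submodule.mem_iSup_of_mem y (Submodule.mem_iSup_of_mem hyz
    (Submodule.mem_iSup_of_mem (f ≫ g) ⟨a, ?_⟩))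
  simp

theorem idealImage_le_comap_app {V W : C ⥤ ModuleCat.{t} k} (φ : V ⟶ W) (x : C) :
    idealImage V x ≤ (idealImage W x).comap (φ.app x).hom := by
  refine iSup_le fun y => iSup_le fun hy => iSup_le fun f => ?_
  rintro _ ⟨a, rfl⟩
  refine Submodule.mem_iSup_of_mem y (Submodule.mem_iSup_of_mem hy
    (Submodule.mem_iSup_of_mem f ⟨(φ.app y).hom a, ?_⟩))
  exact (NatTrans.naturality_apply φ f a).symm

variable [SkeletalEI C]

/-- The `C`-module `H_0(V) = kC/𝔍 ⊗_{kC} V = V / 𝔍 V`, with value `V_x / ∑ V_f (V_y)` at `x`. -/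
@[simps]
def H0Obj (V : C ⥤ ModuleCat.{t} k) : C ⥤ ModuleCat.{t} k where
  obj x := ModuleCat.of k (V.obj x ⧸ idealImage V x)
  map g := ModuleCat.ofHom (Submodule.mapQ _ _ (V.map g).hom (idealImage_le_comap V g))
  map_id x := by
    ext a
    simp
  map_comp f g := by
    ext a
    simp

variable (C k) in
/-- The functor `H_0 = kC/𝔍 ⊗_{kC} -` from `C`-modules to `C`-modules. -/
@[simps]
def H0 : (C ⥤ ModuleCat.{t} k) ⥤ (C ⥤ ModuleCat.{t} k) where
  obj V := H0Obj V
  map φ :=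
    { app := fun x => ModuleCat.ofHom
        (Submodule.mapQ _ _ (φ.app x).hom (idealImage_le_comap_app φ x))
      naturality := fun x y g => by
        refine ModuleCat.hom_ext (LinearMap.ext fun a => ?_)
        obtain ⟨a, rfl⟩ := Submodule.Quotient.mk_surjective _ a
        exact congrArg (Submodule.Quotient.mk) (NatTrans.naturality_apply φ g a) }
  map_id V := by
    refine NatTrans.ext (funext fun x => ModuleCat.hom_ext (LinearMap.ext fun a => ?_))
    obtain ⟨a, rfl⟩ := Submodule.Quotient.mk_surjective _ a
    rfl
  map_comp φ ψ := by
    refine NatTrans.ext (funext fun x => ModuleCat.hom_ext (LinearMap.ext fun a => ?_))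
    obtain ⟨a, rfl⟩ := Submodule.Quotient.mk_surjective _ a
    rfl

instance : (H0.{t} C k).Additive where
  map_add {V W φ ψ} := by
    refine NatTrans.ext (funext fun x => ModuleCat.hom_ext (LinearMap.ext fun a => ?_))
    obtain ⟨a, rfl⟩ := Submodule.Quotient.mk_surjective _ a
    rfl

end Homology

/-! ### Enough projectives -/

theorem enoughProjectives_functor {C : Type u} [Category.{v} C] {D : Type*} [Category* D]
    [EnoughProjectives D] [∀ c d : C, HasCoproductsOfShape (c ⟶ d) D]
    [HasCoproductsOfShape C D] [HasPushouts D] : EnoughProjectives (C ⥤ D) := by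
  refine ⟨fun V => ⟨?_⟩⟩
  let L : C → C ⥤ D := fun c => (evaluationLeftAdjoint D c).obj (Projective.over (V.obj c))
  have hL : ∀ c, Projective (L c) := fun c =>
    (evaluationAdjunctionRight D c).map_projective _ inferInstance
  let p : ∀ c, L c ⟶ V := fun c =>
    ((evaluationAdjunctionRight D c).homEquiv _ _).symm (Projective.π (V.obj c))
  have hp : ∀ c, (evaluationAdjunctionRight D c).unit.app _ ≫ (p c).app c =
      Projective.π (V.obj c) := fun c => by
    have := ((evaluationAdjunctionRight D c).homEquiv _ _).apply_symm_apply
      (Projective.π (V.obj c))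
    rw [Adjunction.homEquiv_unit] at this
    exact this
  have hP : Projective (∐ L) :=
    ⟨fun f e he => ⟨Limits.Sigma.desc fun c => Projective.factorThru (Limits.Sigma.ι L c ≫ f) e,
      Limits.Sigma.hom_ext _ _ fun c => by simp⟩⟩
  have happ : ∀ c, Epi ((Limits.Sigma.desc p).app c) := fun c => by
    have h : ((evaluationAdjunctionRight D c).unit.app _ ≫ (Limits.Sigma.ι L c).app c) ≫
        (Limits.Sigma.desc p).app c = Projective.π (V.obj c) := by
      rw [Category.assoc, ← NatTrans.comp_app, Limits.Sigma.ι_desc, hp]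
    exact epi_of_epi_fac h
  have hepi : Epi (Limits.Sigma.desc p) := NatTrans.epi_of_epi_app _
  exact
    { p := ∐ L
      projective := hP
      f := Limits.Sigma.desc p
      epi := hepi }

instance enoughProjectives_modules (C : Type u) [Category.{v} C] (k : Type w) [CommRing k] :
    EnoughProjectives (C ⥤ ModuleCat.{max u v w} k) := by
  have : HasColimitsOfSize.{v, v} (ModuleCat.{max u v w} k) := inferInstance
  have : HasColimitsOfSize.{u, u} (ModuleCat.{max u v w} k) := inferInstance
  have : EnoughProjectives (ModuleCat.{max u v w} k) := inferInstance
  exact enoughProjectives_functor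

/-! ### Homology and homological degrees -/

section Degrees

variable {C : Type u} [Category.{v} C] [SkeletalEI C] {k : Type w} [CommRing k]
  [HasProjectiveResolutions (C ⥤ ModuleCat.{t} k)]

/-- The homology `H_s(V) = Tor_s^{kC}(kC/𝔍, V)`: the `s`-th left derived functor of
`H_0 = kC/𝔍 ⊗_{kC} -` on the category of `C`-modules. -/
noncomputable def homology (V : C ⥤ ModuleCat.{t} k) (s : ℕ) : C ⥤ ModuleCat.{t} k :=
  ((H0 C k).leftDerived s).obj V

/-- The support of a `C`-module: the objects at which its value is nonzero. -/
def supp {C : Type u} [Category.{v} C] {k : Type w} [CommRing k]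
    (V : C ⥤ ModuleCat.{t} k) : Set C :=
  {x | Nontrivial (V.obj x)}

/-- The homological degree `hd_s(V) = sup {‖x‖ | x ∈ supp H_s(V)}` for the sup norm, where the
objects of `C` are identified with the elements of `ℕ^∞` through `ι`. The value is `⊤` if the
norms are unbounded; the supremum of the empty set is `⊥`, which stands for `-1`. -/
noncomputable def hd (ι : (ℕ →₀ ℕ) ⥤ C) (V : C ⥤ ModuleCat.{t} k) (s : ℕ) : WithBot ℕ∞ :=
  ⨆ (a : ℕ →₀ ℕ) (_ : ι.obj a ∈ supp (homology V s)), ((supNorm a : ℕ∞) : WithBot ℕ∞)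

variable (k) in
/-- `V` is presented in finite degrees: `hd_0(V)` and `hd_1(V)` are finite. -/
def presentedInFiniteDegrees (ι : (ℕ →₀ ℕ) ⥤ C) : ObjectProperty (C ⥤ ModuleCat.{t} k) :=
  fun V => hd ι V 0 < ⊤ ∧ hd ι V 1 < ⊤

end Degrees

/-- The full subcategory of an abelian category `A` on the objects satisfying `P` is an abelian
subcategory: with the addition of morphisms inherited from `A` it is an abelian category, and
its inclusion into `A` is exact. -/
def IsAbelianSubcategory {A : Type u} [Category.{v} A] [Abelian A] (P : ObjectProperty A) : Prop :=
  (∃ h : Abelian P.FullSubcategory, h.toPreadditive = Preadditive.fullSubcategory P) ∧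
    PreservesFiniteLimits P.ι ∧ PreservesFiniteColimits P.ι

end NInftyRep

/-!
The groups of automorphisms play almost no role. Since `C(z, x)` is a torsor under `G_z` whenever it
is nonempty, composition with `x ⟶ y` is a bijection `C(z, x) → C(z, y)` if `C(z, x)` is nonempty.
Hence truncating a sequence at `n` makes the full subcategory on the box `‖x‖ ≤ n` coreflective
(`IsCombinatorial.boxCoreflection`): every morphism from the box to `x` factors uniquely through
`min(x, n) ⟶ x`.

Call a module `V` extended from the box if all maps `V_{min(x, n)} ⟶ V_x` are isomorphisms. The
point is that `V` is extended from the box if and only if `H_0(V)` and `H_1(V)` are supported in the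
box, and that then all `H_s(V)` are.

* The free modules on generators in the box are projective and extended, and an extended module has
  `H_0` supported in the box. If `V` is extended, so is the kernel `K` of a free cover `P ⟶ V`, and
  outside the box `H_{s+1}(V)` vanishes where `H_s(K)` does. Induction on `s` gives
  `Coreflection.IsExtended.isZero_homology_obj`.
* Conversely, if `H_0(V)` is supported in the box, then well-founded induction shows that the maps
  `V_{min(x, n)} ⟶ V_x` are surjective, so that `V` has a free cover `P` as above. If `H_1(V)` is
  supported in the box too, so is `H_0(K)`; the maps `K_{min(x, n)} ⟶ K_x` are then surjective, and
  a diagram chase makes `V_{min(x, n)} ⟶ V_x` injective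
  (`Coreflection.isExtended_of_isZero_homology`).

This gives the bound on the homological degrees when the maximum is a natural number; if it is `-1`,
then `V = 0` by Nakayama's lemma. It also shows that a module is presented in finite degrees if and
only if it is extended from some box. Being extended from a box says that a natural transformation
between evaluation functors, which preserve limits and colimits, is invertible at `V`. It is
therefore stable under kernels, cokernels and finite products, and it is monotone in the box, so the
modules presented in finite degrees form an abelian subcategory.
-/

namespace NInftyRep

/-! ### Dimension shifting for left derived functors -/

section DimensionShifting

variable {A : Type*} [Category* A] [Abelian A] {B : Type*} [Category* B] [Abelian B]

/-- The augmentation `Q₀ ⟶ V` of a projective resolution of `V`, as a morphism of `A` whose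
target is syntactically `V`. -/
noncomputable def augmentation {V : A} (Q : ProjectiveResolution V) : Q.complex.X 0 ⟶ V :=
  Q.π.f 0

instance {V : A} (Q : ProjectiveResolution V) : Epi (augmentation Q) :=
  inferInstanceAs (Epi (Q.π.f 0))

lemma d_comp_augmentation {V : A} (Q : ProjectiveResolution V) :
    Q.complex.d 1 0 ≫ augmentation Q = 0 :=
  Q.complex_d_comp_π_f_zero

lemma exact_augmentation {V : A} (Q : ProjectiveResolution V) :
    (ShortComplex.mk _ _ (d_comp_augmentation Q)).Exact :=
  ShortComplex.exact_of_g_is_cokernel _ Q.isColimitCokernelCofork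

lemma d_comp_augmentation_comp {V P : A} (Q : ProjectiveResolution V) (f : V ⟶ P) :
    Q.complex.d 1 0 ≫ augmentation Q ≫ f = 0 := by
  rw [← Category.assoc, d_comp_augmentation, zero_comp]

lemma augmentation_comp_comp (S : ShortComplex A) (Q : ProjectiveResolution S.X₁) :
    (augmentation Q ≫ S.f) ≫ S.g = 0 := by
  rw [Category.assoc, S.zero, comp_zero]

/-- For a short exact sequence `K ⟶ P ⟶ V` with `P` projective, a projective resolution of `K`
followed by `P` is a projective resolution of `V`. -/
noncomputable def spliceResolution {S : ShortComplex A} (hS : S.ShortExact) [Projective S.X₂]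
    (Q : ProjectiveResolution S.X₁) : ProjectiveResolution S.X₃ where
  complex := Q.complex.augment (augmentation Q ≫ S.f) (d_comp_augmentation_comp Q _)
  projective
    | 0 => (inferInstance : Projective S.X₂)
    | n + 1 => Q.projective n
  π := (ChainComplex.toSingle₀Equiv _ _).symm ⟨S.g, augmentation_comp_comp S Q⟩
  quasiIso := ⟨fun n => by
    have := hS.mono_f
    have := hS.epi_g
    match n with
    | 0 =>
      rw [ChainComplex.quasiIsoAt₀_iff, ShortComplex.quasiIso_iff_of_zeros']
      · have hex : (ShortComplex.mk _ _ (augmentation_comp_comp S Q)).Exact := by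
          let φ : ShortComplex.mk _ _ (augmentation_comp_comp S Q) ⟶ S :=
            { τ₁ := augmentation Q
              τ₂ := 𝟙 _
              τ₃ := 𝟙 _ }
          have : Epi φ.τ₁ := inferInstanceAs (Epi (augmentation Q))
          have : IsIso φ.τ₂ := inferInstanceAs (IsIso (𝟙 _))
          have : Mono φ.τ₃ := inferInstanceAs (Mono (𝟙 _))
          exact (ShortComplex.exact_iff_of_epi_of_isIso_of_mono φ).2 hS.exact
        refine (ShortComplex.exact_and_epi_g_iff_of_iso ?_).2 ⟨hex, hS.epi_g⟩
        refine ShortComplex.isoMk (Iso.refl _) (Iso.refl _) (Iso.refl _) ?_ ?_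
        · exact (Category.id_comp _).trans (Category.comp_id _).symm
        · have h₀ := ChainComplex.toSingle₀Equiv_symm_apply_f_zero
            (C := Q.complex.augment (augmentation Q ≫ S.f) (d_comp_augmentation_comp Q _))
            S.g (augmentation_comp_comp S Q)
          exact (Category.id_comp S.g).trans (h₀.symm.trans (Category.comp_id _).symm)
      all_goals rfl
    | 1 =>
      rw [quasiIsoAt_iff_exactAt' _ _ (ChainComplex.exactAt_succ_single_obj _ _),
        HomologicalComplex.exactAt_iff' _ 2 1 0 (by simp) (by simp)]
      let φ : ShortComplex.mk _ _ (d_comp_augmentation Q) ⟶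
          ShortComplex.mk _ _ (d_comp_augmentation_comp Q S.f) :=
        { τ₁ := 𝟙 _
          τ₂ := 𝟙 _
          τ₃ := S.f }
      have : Epi φ.τ₁ := inferInstanceAs (Epi (𝟙 _))
      have : IsIso φ.τ₂ := inferInstanceAs (IsIso (𝟙 _))
      have : Mono φ.τ₃ := inferInstanceAs (Mono S.f)
      exact (ShortComplex.exact_iff_of_epi_of_isIso_of_mono φ).1 (exact_augmentation Q)
    | n + 2 =>
      rw [quasiIsoAt_iff_exactAt' _ _ (ChainComplex.exactAt_succ_single_obj _ _),
        HomologicalComplex.exactAt_iff' _ (n + 3) (n + 2) (n + 1) (by simp) (by simp)]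
      exact Q.exact_succ n⟩

variable [HasProjectiveResolutions A]

/-- Vanishing of a derived functor at `V` can be tested on any projective resolution. -/
lemma isZero_leftDerived_obj_iff (G : A ⥤ B) [G.Additive] {V : A} (R : ProjectiveResolution V)
    (s : ℕ) : IsZero ((G.leftDerived s).obj V) ↔
      ((G.mapHomologicalComplex _).obj R.complex).ExactAt s := by
  rw [HomologicalComplex.exactAt_iff_isZero_homology]
  exact (R.isoLeftDerivedObj G s).isZero_iff

/-- Dimension shifting at an additive functor which kills the projective middle term. Note that
this includes the degree `0`, where it compares the first derived functor with the zeroth. -/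
lemma isZero_leftDerived_succ_iff (G : A ⥤ B) [G.Additive] {S : ShortComplex A}
    (hS : S.ShortExact) [Projective S.X₂] (h : IsZero (G.obj S.X₂)) (s : ℕ) :
    IsZero ((G.leftDerived (s + 1)).obj S.X₃) ↔ IsZero ((G.leftDerived s).obj S.X₁) := by
  let Q := projectiveResolution S.X₁
  rw [isZero_leftDerived_obj_iff G (spliceResolution hS Q), isZero_leftDerived_obj_iff G Q]
  match s with
  | 0 =>
    -- Both sides say that `G Q₁ ⟶ G Q₀` is an epimorphism, where `Q` resolves `S.X₁`.
    rw [HomologicalComplex.exactAt_iff' _ 2 1 0 (by simp) (by simp),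
      HomologicalComplex.exactAt_iff' _ 1 0 0 (by simp) (by simp),
      ShortComplex.exact_iff_epi _ (h.eq_of_tgt _ _), ShortComplex.exact_iff_epi _ (by
        change G.map (Q.complex.d 0 0) = 0
        rw [Q.complex.shape 0 0 (by simp), G.map_zero])]
    rfl
  | s + 1 =>
    rw [HomologicalComplex.exactAt_iff' _ (s + 3) (s + 2) (s + 1) (by simp) (by simp),
      HomologicalComplex.exactAt_iff' _ (s + 2) (s + 1) s (by simp) (by simp)]
    rfl

end DimensionShifting

/-! ### Homology at an object -/

section HomologyAt

variable {C : Type u} [Category.{v} C] {k : Type w} [CommRing k]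

lemma app_surjective_of_epi {V W : C ⥤ ModuleCat.{t} k} (φ : V ⟶ W) [Epi φ] (x : C) :
    Function.Surjective (φ.app x).hom :=
  (ModuleCat.epi_iff_surjective _).1 inferInstance

/-- An epimorphism `V ⟶ W` maps `𝔍 V` onto `𝔍 W`; this is why `H_0` is right exact. -/
lemma idealImage_eq_map {V W : C ⥤ ModuleCat.{t} k} (φ : V ⟶ W) [Epi φ] (x : C) :
    idealImage W x = (idealImage V x).map (φ.app x).hom := by
  refine le_antisymm ?_ (Submodule.map_le_iff_le_comap.2 (idealImage_le_comap_app φ x))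
  refine iSup_le fun y => iSup_le fun hy => iSup_le fun f => ?_
  rintro _ ⟨b, rfl⟩
  obtain ⟨a, rfl⟩ := app_surjective_of_epi φ y b
  exact ⟨(V.map f).hom a, Submodule.mem_iSup_of_mem y (Submodule.mem_iSup_of_mem hy
    (Submodule.mem_iSup_of_mem f ⟨a, rfl⟩)), NatTrans.naturality_apply φ f a⟩

variable [SkeletalEI C]

variable (k) in
/-- The functor `V ↦ H_0(V)_x`. -/
abbrev H0At (x : C) : (C ⥤ ModuleCat.{t} k) ⥤ ModuleCat.{t} k :=
  H0 C k ⋙ (evaluation C _).obj x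

lemma isZero_H0At_obj_iff (V : C ⥤ ModuleCat.{t} k) (x : C) :
    IsZero ((H0At k x).obj V) ↔ idealImage V x = ⊤ := by
  rw [ModuleCat.isZero_iff_subsingleton]
  exact Submodule.Quotient.subsingleton_iff

instance (x : C) : (H0At.{t} k x).Additive where
  map_add {V W φ ψ} := by
    simp [(H0 C k).map_add]

instance preservesFiniteColimits_H0At (x : C) : PreservesFiniteColimits (H0At.{t} k x) := by
  refine ((H0At.{t} k x).preservesFiniteColimits_iff_forall_exact_map_and_epi).2 fun S hS => ?_
  have := hS.epi_g
  have hg := app_surjective_of_epi S.g x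
  refine ⟨?_, ?_⟩
  · rw [ShortComplex.moduleCat_exact_iff]
    intro a ha
    obtain ⟨a, rfl⟩ := Submodule.Quotient.mk_surjective _ a
    have ha' : (S.g.app x).hom a ∈ idealImage S.X₃ x := (Submodule.Quotient.mk_eq_zero _).1 ha
    rw [idealImage_eq_map S.g x] at ha'
    obtain ⟨b, hb, hab⟩ := ha'
    have hex : (S.map ((evaluation C _).obj x)).Exact := hS.exact.map _
    rw [ShortComplex.moduleCat_exact_iff] at hex
    obtain ⟨c, hc⟩ := hex (a - b) (by
      change (S.g.app x).hom (a - b) = 0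
      rw [map_sub, hab, sub_self])
    refine ⟨Submodule.Quotient.mk c, ?_⟩
    refine (Submodule.Quotient.eq _).2 ?_
    have hc' : (S.f.app x).hom c = a - b := hc
    change (S.f.app x).hom c - a ∈ _
    rw [hc']
    simpa using hb
  · rw [ModuleCat.epi_iff_surjective]
    intro a
    obtain ⟨a, rfl⟩ := Submodule.Quotient.mk_surjective _ a
    obtain ⟨b, rfl⟩ := hg a
    exact ⟨Submodule.Quotient.mk b, rfl⟩

variable [HasProjectiveResolutions (C ⥤ ModuleCat.{t} k)]

/-- Evaluation at `x` is exact, so `H_s(V)_x` vanishes exactly when the `s`-th derived functor of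
`V ↦ H_0(V)_x` does. -/
lemma isZero_homology_obj_iff (V : C ⥤ ModuleCat.{t} k) (s : ℕ) (x : C) :
    IsZero ((homology V s).obj x) ↔ IsZero (((H0At k x).leftDerived s).obj V) := by
  let R := projectiveResolution V
  rw [isZero_leftDerived_obj_iff _ R, HomologicalComplex.exactAt_iff_isZero_homology]
  let K := (((H0 C k).mapHomologicalComplex (ComplexShape.down ℕ)).obj R.complex).sc s
  have e₁ : (homology V s).obj x ≅ ((evaluation C _).obj x).obj K.homology :=
    ((evaluation C _).obj x).mapIso (R.isoLeftDerivedObj (H0 C k) s)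
  exact (e₁ ≪≫ (K.mapHomologyIso ((evaluation C _).obj x)).symm).isZero_iff

lemma isZero_homology_zero_obj_iff (V : C ⥤ ModuleCat.{t} k) (x : C) :
    IsZero ((homology V 0).obj x) ↔ idealImage V x = ⊤ := by
  rw [isZero_homology_obj_iff, ← isZero_H0At_obj_iff]
  exact ((H0At k x).leftDerivedZeroIsoSelf.app V).isZero_iff

/-- Dimension shifting at an object `x` with `H_0(P)_x = 0`. -/
lemma isZero_homology_succ_obj_iff {S : ShortComplex (C ⥤ ModuleCat.{t} k)} (hS : S.ShortExact)
    [Projective S.X₂] {x : C} (hx : idealImage S.X₂ x = ⊤) (s : ℕ) :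
    IsZero ((homology S.X₃ (s + 1)).obj x) ↔ IsZero ((homology S.X₁ s).obj x) := by
  rw [isZero_homology_obj_iff, isZero_homology_obj_iff]
  exact isZero_leftDerived_succ_iff _ hS ((isZero_H0At_obj_iff _ _).2 hx) s

end HomologyAt

/-! ### Modules extended from a coreflective set of objects -/

/-- A coreflection of `C` onto the full subcategory on the objects satisfying `B`: every `x`
has a morphism `counit x : obj x ⟶ x` from an object of `B` through which each morphism from an
object of `B` to `x` factors uniquely. (That `obj` extends to a functor is not needed.) -/
structure Coreflection {C : Type u} [Category.{v} C] (B : C → Prop) where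
  /-- The object of `B` which approximates `x`. -/
  obj : C → C
  /-- The universal morphism from an object of `B` to `x`. -/
  counit : ∀ x, obj x ⟶ x
  prop_obj : ∀ x, B (obj x)
  bijective : ∀ {y : C} (x : C), B y → Function.Bijective fun f : y ⟶ obj x => f ≫ counit x

section Coreflection

variable {C : Type u} [Category.{v} C] {k : Type w} [CommRing k] {B : C → Prop}

namespace Coreflection

variable (T : Coreflection B)

lemma isIso_counit {x : C} (hx : B x) : IsIso (T.counit x) := by
  obtain ⟨s, hs⟩ := (T.bijective x hx).2 (𝟙 x)
  refine ⟨s, (T.bijective x (T.prop_obj x)).1 ?_, hs⟩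
  have hs' : s ≫ T.counit x = 𝟙 x := hs
  simp [hs']

/-- `V` is extended from `B` if it inverts the counits, that is, if it is the left Kan extension
of its restriction to `B`. -/
def IsExtended (V : C ⥤ ModuleCat.{t} k) : Prop :=
  ∀ x, IsIso (V.map (T.counit x))

lemma isExtended_iff_bijective (V : C ⥤ ModuleCat.{t} k) :
    T.IsExtended V ↔ ∀ x, Function.Bijective (V.map (T.counit x)).hom :=
  forall_congr' fun _ => ConcreteCategory.isIso_iff_bijective _

/-- An extended module is generated in `B`: its zeroth homology vanishes off `B`. -/
lemma IsExtended.idealImage_eq_top {V : C ⥤ ModuleCat.{t} k} (hV : T.IsExtended V) {x : C}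
    (hx : ¬ B x) : idealImage V x = ⊤ := by
  have hs := ((T.isExtended_iff_bijective V).1 hV x).2
  rw [← LinearMap.range_eq_top] at hs
  rw [eq_top_iff, ← hs]
  refine le_iSup₂_of_le (T.obj x) (fun h => hx (h ▸ T.prop_obj x)) ?_
  exact le_iSup (fun f : T.obj x ⟶ x => LinearMap.range (V.map f).hom) (T.counit x)

/-- If `V` is generated in `B`, then every `V_x` is the image of `V_y` for the universal
`y ⟶ x` with `y` in `B`. -/
lemma surjective_map_counit (hwf : WellFounded fun y x : C => y ≠ x ∧ Nonempty (y ⟶ x))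
    {V : C ⥤ ModuleCat.{t} k} (hV : ∀ x, ¬ B x → idealImage V x = ⊤) (x : C) :
    Function.Surjective (V.map (T.counit x)).hom := by
  rw [← LinearMap.range_eq_top]
  induction x using hwf.induction with
  | _ x ih =>
    by_cases hx : B x
    · have := T.isIso_counit hx
      exact LinearMap.range_eq_top.2 ((ModuleCat.epi_iff_surjective _).1 inferInstance)
    · rw [eq_top_iff, ← hV x hx]
      refine iSup_le fun y => iSup_le fun hy => iSup_le fun f => ?_
      rw [LinearMap.range_eq_map, ← ih y ⟨hy, ⟨f⟩⟩]
      rintro _ ⟨_, ⟨a, rfl⟩, rfl⟩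
      obtain ⟨g, hg⟩ := (T.bijective x (T.prop_obj y)).2 (T.counit y ≫ f)
      refine ⟨(V.map g).hom a, ?_⟩
      have h := congrArg (fun q => (V.map q).hom a) hg
      simpa using h

end Coreflection

/-- Nakayama's lemma for modules over a category in which there is no infinite descent. -/
lemma isZero_of_idealImage_eq_top (hwf : WellFounded fun y x : C => y ≠ x ∧ Nonempty (y ⟶ x))
    {V : C ⥤ ModuleCat.{t} k} (hV : ∀ x, idealImage V x = ⊤) : IsZero V := by
  refine Functor.isZero _ fun x => ?_
  rw [ModuleCat.isZero_iff_subsingleton, ← Submodule.subsingleton_iff k,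
    ← subsingleton_iff_bot_eq_top, ← hV x]
  induction x using hwf.induction with
  | _ x ih =>
    refine (bot_le.antisymm ?_)
    refine iSup_le fun y => iSup_le fun hy => iSup_le fun f => ?_
    have h := ih y ⟨hy, ⟨f⟩⟩
    rw [hV y] at h
    rw [LinearMap.range_eq_map, ← h, Submodule.map_bot]

/-! ### Free modules generated in a set of objects -/

variable (B) in
/-- The direct sum of the representable modules `k C(c, -)`, one for each object `c` in `B` and
each element of `V_c`: its value at `x` has the pairs of a morphism `c ⟶ x` and an element of
`V_c` as a basis. -/
noncomputable def freeCover (V : C ⥤ ModuleCat.{max u v w} k) : C ⥤ ModuleCat.{max u v w} k where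
  obj x := ModuleCat.of k ((Σ c : {c // B c}, (c.1 ⟶ x) × V.obj c.1) →₀ k)
  map g := ModuleCat.ofHom (Finsupp.lmapDomain k k fun p => ⟨p.1, p.2.1 ≫ g, p.2.2⟩)
  map_id x := by
    refine ModuleCat.hom_ext (Finsupp.lhom_ext' fun p => LinearMap.ext_ring ?_)
    simp [Finsupp.mapDomain_single]
  map_comp f g := by
    refine ModuleCat.hom_ext (Finsupp.lhom_ext' fun p => LinearMap.ext_ring ?_)
    simp [Finsupp.mapDomain_single]

section FreeCover

variable {V : C ⥤ ModuleCat.{max u v w} k}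

/-- The basis element of the free cover given by `f : c ⟶ x` and `a ∈ V_c`. -/
noncomputable def freeCoverMk {x : C} (c : {c // B c}) (f : c.1 ⟶ x) (a : V.obj c.1) :
    (freeCover B V).obj x :=
  Finsupp.single ⟨c, f, a⟩ (1 : k)

lemma freeCover_map_mk {x y : C} (c : {c // B c}) (f : c.1 ⟶ x) (a : V.obj c.1) (g : x ⟶ y) :
    ((freeCover B V).map g).hom (freeCoverMk c f a) = freeCoverMk c (f ≫ g) a :=
  Finsupp.mapDomain_single

lemma freeCover_hom_ext {W : C ⥤ ModuleCat.{max u v w} k} {φ ψ : freeCover B V ⟶ W}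
    (h : ∀ (x : C) (c : {c // B c}) (f : c.1 ⟶ x) (a : V.obj c.1),
      (φ.app x).hom (freeCoverMk c f a) = (ψ.app x).hom (freeCoverMk c f a)) : φ = ψ :=
  NatTrans.ext (funext fun x => ModuleCat.hom_ext
    (Finsupp.lhom_ext' fun p => LinearMap.ext_ring (h x p.1 p.2.1 p.2.2)))

/-- The morphism from the free cover which sends the generator at `a ∈ V_c` to `e c a`. -/
noncomputable def freeCoverDesc {W : C ⥤ ModuleCat.{max u v w} k}
    (e : ∀ c : {c // B c}, V.obj c.1 → W.obj c.1) : freeCover B V ⟶ W where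
  app x := ModuleCat.ofHom (Finsupp.linearCombination k fun p => (W.map p.2.1).hom (e p.1 p.2.2))
  naturality x y g := by
    refine ModuleCat.hom_ext (Finsupp.lhom_ext' fun p => LinearMap.ext_ring ?_)
    simp [freeCover, Finsupp.mapDomain_single]

lemma freeCoverDesc_mk {W : C ⥤ ModuleCat.{max u v w} k}
    (e : ∀ c : {c // B c}, V.obj c.1 → W.obj c.1) {x : C} (c : {c // B c}) (f : c.1 ⟶ x)
    (a : V.obj c.1) :
    ((freeCoverDesc e).app x).hom (freeCoverMk c f a) = (W.map f).hom (e c a) := by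
  refine (Finsupp.linearCombination_single k (1 : k) _).trans ?_
  simp

instance projective_freeCover : Projective (freeCover B V) where
  factors {E W} f e he := by
    choose s hs using fun (c : {c // B c}) (a : V.obj c.1) =>
      app_surjective_of_epi e c.1 ((f.app c.1).hom (freeCoverMk c (𝟙 _) a))
    refine ⟨freeCoverDesc s, freeCover_hom_ext fun x c g a => ?_⟩
    have h₁ : (e.app x).hom ((E.map g).hom (s c a)) = (W.map g).hom ((e.app c.1).hom (s c a)) :=
      NatTrans.naturality_apply e g (s c a)
    have h₂ : (f.app x).hom (((freeCover B V).map g).hom (freeCoverMk c (𝟙 _) a)) =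
        (W.map g).hom ((f.app c.1).hom (freeCoverMk c (𝟙 _) a)) :=
      NatTrans.naturality_apply f g _
    rw [freeCover_map_mk, Category.id_comp] at h₂
    rw [h₂, ← hs, ← h₁, NatTrans.comp_app, ModuleCat.hom_comp, LinearMap.comp_apply,
      freeCoverDesc_mk]

lemma isExtended_freeCover (T : Coreflection B) : T.IsExtended (freeCover B V) := by
  rw [T.isExtended_iff_bijective]
  intro x
  let e : (Σ c : {c // B c}, (c.1 ⟶ T.obj x) × V.obj c.1) ≃
      (Σ c : {c // B c}, (c.1 ⟶ x) × V.obj c.1) :=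
    Equiv.sigmaCongrRight fun c =>
      (Equiv.ofBijective _ (T.bijective x c.2)).prodCongr (Equiv.refl _)
  have he : ⇑((freeCover B V).map (T.counit x)).hom = Finsupp.domLCongr (R := k) (M := k) e :=
    funext fun p => (Finsupp.equivMapDomain_eq_mapDomain e p).symm
  rw [he]
  exact LinearEquiv.bijective _

/-- The canonical morphism from the free cover on the elements of `V` at objects of `B`. -/
noncomputable def freeCoverπ (B : C → Prop) (V : C ⥤ ModuleCat.{max u v w} k) :
    freeCover B V ⟶ V :=
  freeCoverDesc fun _ a => a

lemma epi_freeCoverπ (T : Coreflection B)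
    (hV : ∀ x, Function.Surjective (V.map (T.counit x)).hom) : Epi (freeCoverπ B V) := by
  have : ∀ x, Epi ((freeCoverπ B V).app x) := fun x => by
    rw [ModuleCat.epi_iff_surjective]
    intro b
    obtain ⟨a, rfl⟩ := hV x b
    exact ⟨freeCoverMk ⟨_, T.prop_obj x⟩ (T.counit x) a, freeCoverDesc_mk _ _ _ _⟩
  exact NatTrans.epi_of_epi_app _

end FreeCover

end Coreflection

/-! ### Limits and colimits of extended modules -/

section Closure

lemma isIso_app_of_isLimit {A D J : Type*} [Category* A] [Category* D] [Category* J]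
    {F G : A ⥤ D} (α : F ⟶ G) {K : J ⥤ A} {c : Cone K} (hc : IsLimit c)
    [PreservesLimit K F] [PreservesLimit K G] (h : ∀ j, IsIso (α.app (K.obj j))) :
    IsIso (α.app c.pt) := by
  let β : K ⋙ F ≅ K ⋙ G :=
    NatIso.ofComponents (fun j => asIso (α.app (K.obj j))) fun f => α.naturality (K.map f)
  have : α.app c.pt = (IsLimit.conePointsIsoOfNatIso (isLimitOfPreserves F hc)
      (isLimitOfPreserves G hc) β).hom := by
    refine (isLimitOfPreserves G hc).hom_ext fun j => ?_
    rw [IsLimit.conePointsIsoOfNatIso_hom_comp]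
    exact (α.naturality (c.π.app j)).symm
  rw [this]
  infer_instance

lemma isIso_app_of_isColimit {A D J : Type*} [Category* A] [Category* D] [Category* J]
    {F G : A ⥤ D} (α : F ⟶ G) {K : J ⥤ A} {c : Cocone K} (hc : IsColimit c)
    [PreservesColimit K F] [PreservesColimit K G] (h : ∀ j, IsIso (α.app (K.obj j))) :
    IsIso (α.app c.pt) := by
  let β : K ⋙ F ≅ K ⋙ G :=
    NatIso.ofComponents (fun j => asIso (α.app (K.obj j))) fun f => α.naturality (K.map f)
  have : α.app c.pt = (IsColimit.coconePointsIsoOfNatIso (isColimitOfPreserves F hc)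
      (isColimitOfPreserves G hc) β).hom := by
    refine (isColimitOfPreserves F hc).hom_ext fun j => ?_
    rw [IsColimit.comp_coconePointsIsoOfNatIso_hom]
    exact α.naturality (c.ι.app j)
  rw [this]
  infer_instance

variable {C : Type u} [Category.{v} C] {k : Type w} [CommRing k] {B : C → Prop}
  (T : Coreflection B)

namespace Coreflection

lemma isExtended_of_isLimit {J : Type*} [Category* J] {K : J ⥤ C ⥤ ModuleCat.{t} k} {c : Cone K}
    (hc : IsLimit c) [∀ x, PreservesLimit K ((evaluation C (ModuleCat.{t} k)).obj x)]
    (h : ∀ j, T.IsExtended (K.obj j)) : T.IsExtended c.pt :=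
  fun x => isIso_app_of_isLimit ((evaluation C (ModuleCat.{t} k)).map (T.counit x)) hc
    fun j => h j x

lemma isExtended_of_isColimit {J : Type*} [Category* J] {K : J ⥤ C ⥤ ModuleCat.{t} k}
    {c : Cocone K} (hc : IsColimit c)
    [∀ x, PreservesColimit K ((evaluation C (ModuleCat.{t} k)).obj x)]
    (h : ∀ j, T.IsExtended (K.obj j)) : T.IsExtended c.pt :=
  fun x => isIso_app_of_isColimit ((evaluation C (ModuleCat.{t} k)).map (T.counit x)) hc
    fun j => h j x

lemma isExtended_of_kernelFork {V W : C ⥤ ModuleCat.{t} k} {f : V ⟶ W} {c : KernelFork f}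
    (hc : IsLimit c) (hV : T.IsExtended V) (hW : T.IsExtended W) : T.IsExtended c.pt :=
  T.isExtended_of_isLimit hc fun | .zero => hV | .one => hW

lemma isExtended_of_cokernelCofork {V W : C ⥤ ModuleCat.{t} k} {f : V ⟶ W} {c : CokernelCofork f}
    (hc : IsColimit c) (hV : T.IsExtended V) (hW : T.IsExtended W) : T.IsExtended c.pt :=
  T.isExtended_of_isColimit hc fun | .zero => hV | .one => hW

end Coreflection

end Closure

/-! ### Extended modules and homology -/

section Characterization

variable {C : Type u} [Category.{v} C] {k : Type w} [CommRing k] {B : C → Prop}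
  (T : Coreflection B)

/-- The presentation of `V` by its free cover. -/
noncomputable abbrev freeCoverComplex (B : C → Prop) (V : C ⥤ ModuleCat.{max u v w} k) :
    ShortComplex (C ⥤ ModuleCat.{max u v w} k) :=
  ShortComplex.mk (kernel.ι (freeCoverπ B V)) (freeCoverπ B V) (kernel.condition _)

lemma shortExact_freeCoverComplex {V : C ⥤ ModuleCat.{max u v w} k}
    (hV : ∀ x, Function.Surjective (V.map (T.counit x)).hom) :
    (freeCoverComplex B V).ShortExact :=
  have := epi_freeCoverπ T hV
  { exact := ShortComplex.exact_of_f_is_kernel _ (kernelIsKernel _)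
    mono_f := inferInstanceAs (Mono (kernel.ι _))
    epi_g := this }

/-- A quotient of an extended module is extended if the transition maps of `V` and of the kernel
along the counits are surjective. -/
lemma Coreflection.isExtended_of_shortExact {S : ShortComplex (C ⥤ ModuleCat.{t} k)}
    (hS : S.ShortExact) (h₁ : ∀ x, Function.Surjective (S.X₁.map (T.counit x)).hom)
    (h₂ : T.IsExtended S.X₂) (h₃ : ∀ x, Function.Surjective (S.X₃.map (T.counit x)).hom) :
    T.IsExtended S.X₃ := by
  rw [T.isExtended_iff_bijective] at h₂ ⊢
  refine fun x => ⟨?_, h₃ x⟩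
  rw [injective_iff_map_eq_zero]
  intro a ha
  have := hS.epi_g
  obtain ⟨p, rfl⟩ := app_surjective_of_epi S.g _ a
  have hex : (S.map ((evaluation C _).obj x)).Exact := hS.exact.map _
  rw [ShortComplex.moduleCat_exact_iff] at hex
  obtain ⟨c, hc⟩ := hex ((S.X₂.map (T.counit x)).hom p)
    ((NatTrans.naturality_apply S.g (T.counit x) p).trans ha)
  obtain ⟨c, rfl⟩ := h₁ x c
  have hp : (S.f.app _).hom c = p :=
    (h₂ x).1 ((NatTrans.naturality_apply S.f (T.counit x) c).symm.trans hc)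
  rw [← hp]
  exact congrArg (fun φ => (φ.app _).hom c) S.zero

variable [SkeletalEI C]

/-- The homology of an extended module is supported in `B`. -/
lemma Coreflection.IsExtended.isZero_homology_obj {V : C ⥤ ModuleCat.{max u v w} k}
    (hV : T.IsExtended V) (s : ℕ) {x : C} (hx : ¬ B x) : IsZero ((homology V s).obj x) := by
  induction s generalizing V with
  | zero => exact (isZero_homology_zero_obj_iff V x).2 (hV.idealImage_eq_top T hx)
  | succ s ih =>
    have hS := shortExact_freeCoverComplex T fun x => ((T.isExtended_iff_bijective V).1 hV x).2
    have hP : T.IsExtended (freeCover B V) := isExtended_freeCover T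
    refine (isZero_homology_succ_obj_iff hS (hP.idealImage_eq_top T hx) s).2 (ih ?_)
    have hK := T.isExtended_of_kernelFork (kernelIsKernel (freeCoverπ B V)) hP hV
    exact hK

/-- A module whose homology in degrees `0` and `1` is supported in `B` is extended from `B`. -/
lemma Coreflection.isExtended_of_isZero_homology
    (hwf : WellFounded fun y x : C => y ≠ x ∧ Nonempty (y ⟶ x)) {V : C ⥤ ModuleCat.{max u v w} k}
    (h₀ : ∀ x, ¬ B x → IsZero ((homology V 0).obj x))
    (h₁ : ∀ x, ¬ B x → IsZero ((homology V 1).obj x)) : T.IsExtended V := by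
  have hV := T.surjective_map_counit hwf fun x hx =>
    (isZero_homology_zero_obj_iff V x).1 (h₀ x hx)
  have hS := shortExact_freeCoverComplex T hV
  have hP : T.IsExtended (freeCover B V) := isExtended_freeCover T
  refine T.isExtended_of_shortExact hS (T.surjective_map_counit hwf fun x hx => ?_) hP hV
  rw [← isZero_homology_zero_obj_iff]
  exact (isZero_homology_succ_obj_iff hS (hP.idealImage_eq_top T hx) 0).1 (h₁ x hx)

end Characterization

/-! ### Boxes in `ℕ^∞` -/

section Box

/-- The componentwise minimum of `a` with the constant sequence `n`. -/
noncomputable def truncate (n : ℕ) (a : ℕ →₀ ℕ) : ℕ →₀ ℕ :=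
  a.mapRange (min · n) (Nat.zero_min n)

lemma truncate_le (n : ℕ) (a : ℕ →₀ ℕ) : truncate n a ≤ a :=
  fun _ => min_le_left _ _

lemma supNorm_le_iff {n : ℕ} {a : ℕ →₀ ℕ} : supNorm a ≤ n ↔ ∀ i, a i ≤ n := by
  refine Finset.sup_le_iff.trans ⟨fun h i => ?_, fun h i _ => h i⟩
  by_cases hi : i ∈ a.support
  · exact h i hi
  · rw [Finsupp.notMem_support_iff.1 hi]
    exact Nat.zero_le n

lemma supNorm_truncate_le (n : ℕ) (a : ℕ →₀ ℕ) : supNorm (truncate n a) ≤ n :=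
  supNorm_le_iff.2 fun _ => min_le_right _ _

lemma le_truncate {n : ℕ} {a b : ℕ →₀ ℕ} (hb : supNorm b ≤ n) (h : b ≤ a) : b ≤ truncate n a :=
  fun i => le_min (h i) (supNorm_le_iff.1 hb i)

end Box

/-! ### Combinatorial categories -/

section Combinatorial

variable {C : Type u} [Category.{v} C] [SkeletalEI C] {ι : (ℕ →₀ ℕ) ⥤ C}

/-- The set of objects of sup norm at most `n`. -/
def Box (ι : (ℕ →₀ ℕ) ⥤ C) (n : ℕ) (x : C) : Prop :=
  ∃ a, supNorm a ≤ n ∧ ι.obj a = x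

namespace IsCombinatorial

lemma wellFounded (hι : IsCombinatorial ι) :
    WellFounded fun y x : C => y ≠ x ∧ Nonempty (y ⟶ x) := by
  let e := Equiv.ofBijective _ hι.bijective_obj
  refine Subrelation.wf (r := InvImage (· < ·) e.symm) ?_ (InvImage.wf _ wellFounded_lt)
  rintro y x ⟨hne, ⟨f⟩⟩
  obtain ⟨a, rfl⟩ := e.surjective x
  obtain ⟨b, rfl⟩ := e.surjective y
  change e.symm (e b) < e.symm (e a)
  rw [e.symm_apply_apply, e.symm_apply_apply]
  exact lt_of_le_of_ne (hι.le_of_hom f) fun h => hne (h ▸ rfl)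

lemma box_obj_iff (hι : IsCombinatorial ι) {n : ℕ} {a : ℕ →₀ ℕ} :
    Box ι n (ι.obj a) ↔ supNorm a ≤ n :=
  ⟨fun ⟨_, hb, h⟩ => hι.bijective_obj.1 h ▸ hb, fun h => ⟨a, h, rfl⟩⟩

/-- Postcomposition with a morphism `f : x ⟶ y` is a bijection from `C(z, x)` to `C(z, y)` when
`C(z, x)` is nonempty, since both are torsors under `G_z`. -/
lemma bijective_comp (hι : IsCombinatorial ι) {x y z : C} (g : z ⟶ x) (f : x ⟶ y) :
    Function.Bijective fun h : z ⟶ x => h ≫ f := by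
  refine ⟨fun h₁ h₂ h => ?_, fun h => ?_⟩
  · obtain ⟨p, rfl⟩ := hι.right_transitive h₁ h₂
    have hp : h₁ ≫ f = (p ≫ h₁) ≫ f := h
    rw [Category.assoc] at hp
    rw [hι.right_free p _ hp.symm, Category.id_comp]
  · obtain ⟨p, hp⟩ := hι.right_transitive (g ≫ f) h
    exact ⟨p ≫ g, (Category.assoc _ _ _).trans hp⟩

/-- Truncation is a coreflection of `C` onto the box of the objects of sup norm at most `n`. -/
noncomputable def boxCoreflection (hι : IsCombinatorial ι) (n : ℕ) : Coreflection (Box ι n) :=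
  let e := Equiv.ofBijective _ hι.bijective_obj
  { obj := fun x => ι.obj (truncate n (e.symm x))
    counit := fun x =>
      ι.map (homOfLE (truncate_le n _)) ≫ eqToHom (e.apply_symm_apply x)
    prop_obj := fun x => ⟨_, supNorm_truncate_le n _, rfl⟩
    bijective := by
      rintro _ x ⟨b, hb, rfl⟩
      by_cases h : b ≤ e.symm x
      · exact hι.bijective_comp (ι.map (homOfLE (le_truncate hb h))) _
      · have h₁ : IsEmpty (ι.obj b ⟶ x) :=
          ⟨fun f => h (hι.le_of_hom (f ≫ eqToHom (e.apply_symm_apply x).symm))⟩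
        have h₂ : IsEmpty (ι.obj b ⟶ ι.obj (truncate n (e.symm x))) :=
          ⟨fun f => h ((hι.le_of_hom f).trans (truncate_le n _))⟩
        exact ⟨fun f => h₂.elim f, fun f => h₁.elim f⟩ }

end IsCombinatorial

/-! ### Homological degrees -/

variable {k : Type w} [CommRing k]

lemma hd_le_iff [HasProjectiveResolutions (C ⥤ ModuleCat.{t} k)] (hι : IsCombinatorial ι)
    (V : C ⥤ ModuleCat.{t} k) (s n : ℕ) :
    hd ι V s ≤ ((n : ℕ∞) : WithBot ℕ∞) ↔
      ∀ x, ¬ Box ι n x → IsZero ((homology V s).obj x) := by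
  rw [hd, iSup₂_le_iff]
  refine ⟨fun h x hx => ?_, fun h a ha => ?_⟩
  · obtain ⟨a, rfl⟩ := hι.bijective_obj.2 x
    rw [ModuleCat.isZero_iff_subsingleton, ← not_nontrivial_iff_subsingleton]
    exact fun ha => hx (hι.box_obj_iff.2 (by exact_mod_cast h a ha))
  · by_contra hn
    have hz := h (ι.obj a) fun hb => hn (by exact_mod_cast hι.box_obj_iff.1 hb)
    rw [ModuleCat.isZero_iff_subsingleton, ← not_nontrivial_iff_subsingleton] at hz
    exact hz ha

/-- The value `⊥`, that is `-1`, means that the homology vanishes. -/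
lemma hd_eq_bot_iff [HasProjectiveResolutions (C ⥤ ModuleCat.{t} k)] (hι : IsCombinatorial ι)
    (V : C ⥤ ModuleCat.{t} k) (s : ℕ) :
    hd ι V s = ⊥ ↔ ∀ x, IsZero ((homology V s).obj x) := by
  simp only [hd, iSup_eq_bot, ModuleCat.isZero_iff_subsingleton, ← not_nontrivial_iff_subsingleton]
  refine ⟨fun h x hx => ?_, fun h a ha => (h _ ha).elim⟩
  obtain ⟨a, rfl⟩ := hι.bijective_obj.2 x
  exact WithBot.coe_ne_bot (h a hx)

/-- A module is extended from the box of size `n` if and only if its homology in degrees `0` and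
`1` is supported in that box. -/
lemma isExtended_boxCoreflection_iff (hι : IsCombinatorial ι) (V : C ⥤ ModuleCat.{max u v w} k)
    (n : ℕ) : (hι.boxCoreflection n).IsExtended V ↔
      hd ι V 0 ≤ ((n : ℕ∞) : WithBot ℕ∞) ∧ hd ι V 1 ≤ ((n : ℕ∞) : WithBot ℕ∞) := by
  rw [hd_le_iff hι, hd_le_iff hι]
  exact ⟨fun h => ⟨fun _ hx => h.isZero_homology_obj _ 0 hx,
      fun _ hx => h.isZero_homology_obj _ 1 hx⟩,
    fun h => Coreflection.isExtended_of_isZero_homology _ hι.wellFounded h.1 h.2⟩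

lemma hd_le_max (hι : IsCombinatorial ι) (V : C ⥤ ModuleCat.{max u v w} k) (s : ℕ) :
    hd ι V s ≤ max (hd ι V 0) (hd ι V 1) := by
  generalize hM : max (hd ι V 0) (hd ι V 1) = M
  induction M using WithBot.recBotCoe with
  | bot =>
    -- The value `-1`: here `H_0(V) = 0`, so that `V = 0`.
    have h₀ := (hd_eq_bot_iff hι V 0).1 (max_eq_bot.1 hM).1
    have hV : IsZero V := isZero_of_idealImage_eq_top hι.wellFounded fun x =>
      (isZero_homology_zero_obj_iff V x).1 (h₀ x)
    have := hV.projective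
    refine ((hd_eq_bot_iff hι V s).2 fun x => ?_).le
    match s with
    | 0 => exact h₀ x
    | s + 1 =>
      have hs := (H0 C k).isZero_leftDerived_obj_projective_succ s V
      exact (Functor.isZero_iff _).1 hs x
  | coe M =>
    induction M using ENat.recTopCoe with
    | top => exact le_top
    | coe n =>
      have h := (isExtended_boxCoreflection_iff hι V n).2 (max_le_iff.1 hM.le)
      exact (hd_le_iff hι V s n).2 fun x hx => h.isZero_homology_obj _ s hx

/-! ### Modules presented in finite degrees -/

lemma isExtended_mono (hι : IsCombinatorial ι) {V : C ⥤ ModuleCat.{max u v w} k} {m n : ℕ}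
    (h : m ≤ n) (hV : (hι.boxCoreflection m).IsExtended V) :
    (hι.boxCoreflection n).IsExtended V := by
  rw [isExtended_boxCoreflection_iff] at hV ⊢
  have hmn : ((m : ℕ∞) : WithBot ℕ∞) ≤ ((n : ℕ∞) : WithBot ℕ∞) := by exact_mod_cast h
  exact ⟨hV.1.trans hmn, hV.2.trans hmn⟩

lemma lt_top_iff_exists_le (d : WithBot ℕ∞) :
    d < ⊤ ↔ ∃ n : ℕ, d ≤ ((n : ℕ∞) : WithBot ℕ∞) := by
  refine ⟨fun h => ?_, fun ⟨n, hn⟩ => hn.trans_lt (WithBot.coe_lt_coe.2 (ENat.natCast_lt_top n))⟩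
  match d, h with
  | ⊥, _ => exact ⟨0, bot_le⟩
  | ((n : ℕ) : ℕ∞), _ => exact ⟨n, le_rfl⟩

lemma presentedInFiniteDegrees_iff (hι : IsCombinatorial ι) (V : C ⥤ ModuleCat.{max u v w} k) :
    presentedInFiniteDegrees k ι V ↔ ∃ n, (hι.boxCoreflection n).IsExtended V := by
  simp only [isExtended_boxCoreflection_iff, ← max_le_iff, ← lt_top_iff_exists_le, max_lt_iff]
  rfl

/-- Two modules presented in finite degrees are extended from a common box, so it suffices to
check closure properties for the modules extended from each single box. -/
lemma presentedInFiniteDegrees_of_isExtended (hι : IsCombinatorial ι)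
    {V W E : C ⥤ ModuleCat.{max u v w} k}
    (h : ∀ n, (hι.boxCoreflection n).IsExtended V → (hι.boxCoreflection n).IsExtended W →
      (hι.boxCoreflection n).IsExtended E)
    (hV : presentedInFiniteDegrees k ι V) (hW : presentedInFiniteDegrees k ι W) :
    presentedInFiniteDegrees k ι E := by
  rw [presentedInFiniteDegrees_iff hι] at hV hW ⊢
  obtain ⟨m, hV⟩ := hV
  obtain ⟨n, hW⟩ := hW
  exact ⟨max m n, h _ (isExtended_mono hι (le_max_left m n) hV)
    (isExtended_mono hι (le_max_right m n) hW)⟩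

lemma isAbelianSubcategory_presentedInFiniteDegrees (hι : IsCombinatorial ι) :
    IsAbelianSubcategory (presentedInFiniteDegrees.{max u v w} k ι) := by
  have hK : (presentedInFiniteDegrees.{max u v w} k ι).IsClosedUnderKernels := ⟨by
    rintro _ ⟨f, c, hc, hV, hW⟩
    exact presentedInFiniteDegrees_of_isExtended hι
      (fun n => (hι.boxCoreflection n).isExtended_of_kernelFork hc) hV hW⟩
  have hQ : (presentedInFiniteDegrees.{max u v w} k ι).IsClosedUnderCokernels := ⟨by
    rintro _ ⟨f, c, hc, hV, hW⟩
    exact presentedInFiniteDegrees_of_isExtended hι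
      (fun n => (hι.boxCoreflection n).isExtended_of_cokernelCofork hc) hV hW⟩
  have h₀ : (presentedInFiniteDegrees.{max u v w} k ι).ContainsZero := by
    refine ⟨_, isZero_zero _, (presentedInFiniteDegrees_iff hι _).2 ⟨0, fun x => ?_⟩⟩
    exact ⟨0, (Functor.isZero_iff _).1 (isZero_zero _) _ |>.eq_of_src _ _,
      (Functor.isZero_iff _).1 (isZero_zero _) _ |>.eq_of_src _ _⟩
  have hP : (presentedInFiniteDegrees.{max u v w} k ι).IsClosedUnderFiniteProducts := ⟨by
    refine fun J _ => ⟨?_⟩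
    rintro V ⟨p⟩
    have := Fintype.ofFinite J
    choose n hn using fun j => (presentedInFiniteDegrees_iff hι _).1 (p.prop_diag_obj ⟨j⟩)
    refine (presentedInFiniteDegrees_iff hι V).2 ⟨Finset.univ.sup n, ?_⟩
    exact (hι.boxCoreflection _).isExtended_of_isLimit p.isLimit fun ⟨j⟩ =>
      isExtended_mono hι (Finset.le_sup (Finset.mem_univ j)) (hn j)⟩
  let P := presentedInFiniteDegrees.{max u v w} k ι
  have h₁ : ∀ ⦃V W : P.FullSubcategory⦄ (f : V ⟶ W), PreservesLimit (parallelPair f 0) P.ι :=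
    fun V W f => P.preservesKernels_ι f
  have h₂ : ∀ ⦃V W : P.FullSubcategory⦄ (f : V ⟶ W), PreservesColimit (parallelPair f 0) P.ι :=
    fun V W f => P.preservesCokernels_ι f
  have : P.ι.PreservesHomology :=
    { preservesKernels := fun _ _ f => h₁ f
      preservesCokernels := fun _ _ f => h₂ f }
  exact ⟨⟨inferInstance, rfl⟩, P.ι.preservesFiniteLimits_of_preservesHomology,
    P.ι.preservesFiniteColimits_of_preservesHomology⟩

end Combinatorial

end NInftyRep

theorem theorem1p2 {C : Type u} [Category.{v} C] [NInftyRep.SkeletalEI C]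
    (ι : (ℕ →₀ ℕ) ⥤ C) (hι : NInftyRep.IsCombinatorial ι) (k : Type w) [CommRing k] :
    (∀ (V : C ⥤ ModuleCat.{max u v w} k) (s : ℕ),
      NInftyRep.hd ι V s ≤ max (NInftyRep.hd ι V 0) (NInftyRep.hd ι V 1)) ∧
    NInftyRep.IsAbelianSubcategory
      (NInftyRep.presentedInFiniteDegrees.{max u v w} k ι) :=
  ⟨NInftyRep.hd_le_max hι, NInftyRep.isAbelianSubcategory_presentedInFiniteDegrees hι⟩
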